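/- A \emph{directed column-convex polyomino} (dccp) is a finite set $P$ of unit cells of the square lattice, taken up to translation, such that every cell of $P$ can be reached from the bottom left-hand corner cell of $P$ (the origin) by a path of north and east steps inside $P$, and such that the cells of $P$ in each column are consecutive. Its \emph{area} is its number of cells. The \emph{initial altitude} $a_i$ of its $i$-th column (counted from the left) is the height of the lowest cell of that column. For an integer $d\ge 0$, a dccp with $k$ columns is \emph{$d$-restricted} if $k\le 2$ or $a_{i+1}-a_i\ge d$ for all $2\le i\le k-1$. The \emph{internal path length} of a cell $c$ of $P$ is the minimum number of cells, both ends counted, on a path from the origin to $c$ that moves inside $P$ between cells sharing a side (so the origin has internal path length $1$). The \emph{total internal path length} of $P$ is the sum of the internal path lengths of its cells. \textbf{Theorem.} For $d\ge 0$ and $n\ge 0$, let $t_d(n)$ be the sum of the total internal path lengths of all $d$-restricted dccp of area $n$. Then, as formal power series, $$\sum_{n\ge 0} t_d(n)x^n=\frac{f_d(x)}{g_d(x)},$$ where $g_d(x)=2\left((x-1)^3-(x-1)x^{d+1}\right)^3$ (which has non-zero constant term) and \begin{align*} f_d(x)={}&-(d^2+7d+18)x^{d+3}+2(2d^2+10d+13)x^{d+4}-2(3d^2+9d+11)x^{d+5}\\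 &+4(d^2+d+2)x^{d+6}-(d^2-3d-10)x^{2d+4}+(2d^2-4d-6)x^{2d+5}+6x^{d+2}\\ &-(d-1)d\,x^{d+7}-6x^{2d+3}-(d-1)d\,x^{2d+6}+2x^{3d+4}\\ &-6x^7+22x^6-30x^5+20x^4-10x^3+6x^2-2x. \end{align*} -/

import Mathlib

open Polynomial

namespace Dccp

/-- A cell of the square lattice, named by its column (first coordinate) and its altitude
(second coordinate). -/
abbrev Cell := ℤ × ℤ

/-- A north or an east step that stays inside `P`. -/
def NEStep (P : Finset Cell) (a b : Cell) : Prop :=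
  a ∈ P ∧ b ∈ P ∧ (b = (a.1 + 1, a.2) ∨ b = (a.1, a.2 + 1))

/-- `P` is directed: every cell of `P` is joined to the bottom left-hand corner cell by a path
inside `P` made of north and east steps. Polyominoes are taken up to translation, and the
representative used has its corner cell at `(0, 0)`. The empty polyomino is allowed. -/
def IsDirected (P : Finset Cell) : Prop :=
  (P.Nonempty → ((0, 0) : Cell) ∈ P) ∧
    ∀ c ∈ P, Relation.ReflTransGen (NEStep P) (0, 0) c

/-- `P` is column-convex: the cells of a column between two cells of `P` belong to `P`. -/
def IsColumnConvex (P : Finset Cell) : Prop :=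
  ∀ i y₁ y y₂ : ℤ, (i, y₁) ∈ P → (i, y₂) ∈ P → y₁ ≤ y → y ≤ y₂ → (i, y) ∈ P

/-- Directed column-convex polyominoes, with their bottom left-hand corner cell at the origin. -/
def IsDccp (P : Finset Cell) : Prop := IsDirected P ∧ IsColumnConvex P

/-- `a` is the initial altitude of column `i` of `P`: the altitude of its lowest cell.
This holds for no `a` when `P` has no cell in column `i`. -/
def IsInitialAltitude (P : Finset Cell) (i a : ℤ) : Prop :=
  IsLeast {y : ℤ | (i, y) ∈ P} a

/-- `P` has at most two columns, or the initial altitude grows by at least `d` from each column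
other than the first one (which is column `0`) to the next column. -/
def IsRestricted (d : ℕ) (P : Finset Cell) : Prop :=
  (P.image Prod.fst).card ≤ 2 ∨
    ∀ i a b : ℤ, 1 ≤ i → IsInitialAltitude P i a → IsInitialAltitude P (i + 1) b →
      (d : ℤ) ≤ b - a

/-- The graph whose edges join the cells of `P` that share a side. -/
def cellGraph (P : Finset Cell) : SimpleGraph Cell :=
  SimpleGraph.fromRel (NEStep P)

/-- The internal path length of a cell `c`: the least number of cells on a path in `P` from the
origin cell to `c`, both ends counted (so the origin has internal path length `1`). -/
noncomputable def ipl (P : Finset Cell) (c : Cell) : ℕ :=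
  (cellGraph P).dist (0, 0) c + 1

/-- The total internal path length. -/
noncomputable def tipl (P : Finset Cell) : ℕ := ∑ c ∈ P, ipl P c

/-- The `d`-restricted directed column-convex polyominoes of area `n`. -/
def restrictedDccp (d n : ℕ) : Set (Finset Cell) :=
  {P | IsDccp P ∧ IsRestricted d P ∧ P.card = n}

theorem exists_subset_of_reachable (P : Finset Cell) (h0 : ((0, 0) : Cell) ∈ P) (c : Cell)
    (h : Relation.ReflTransGen (NEStep P) (0, 0) c) :
    0 ≤ c.1 ∧ 0 ≤ c.2 ∧ ∃ Q ⊆ P, (Q.card : ℤ) = c.1 + c.2 + 1 ∧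
      ∀ q ∈ Q, q.1 + q.2 ≤ c.1 + c.2 := by
  induction h with
  | refl => exact ⟨le_rfl, le_rfl, {(0, 0)}, by simpa using h0, by simp, by simp⟩
  | @tail b c _ hbc ih =>
    obtain ⟨h1, h2, Q, hQ, hcard, hle⟩ := ih
    obtain ⟨_, hc, hs⟩ := hbc
    have hsum : c.1 + c.2 = b.1 + b.2 + 1 := by
      rcases hs with rfl | rfl <;> simp <;> ring
    have hnot : c ∉ Q := fun hcQ => by have := hle c hcQ; omega
    refine ⟨?_, ?_, insert c Q, Finset.insert_subset hc hQ, ?_, ?_⟩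
    · rcases hs with rfl | rfl <;> simp <;> omega
    · rcases hs with rfl | rfl <;> simp <;> omega
    · rw [Finset.card_insert_of_notMem hnot]; push_cast; omega
    · intro q hq
      rcases Finset.mem_insert.1 hq with rfl | hq
      · exact le_rfl
      · have := hle q hq; omega

theorem restrictedDccp_finite (d n : ℕ) : (restrictedDccp d n).Finite := by
  refine Set.Finite.subset
    (Finset.finite_toSet ((Finset.Icc (0 : ℤ) n ×ˢ Finset.Icc (0 : ℤ) n).powerset)) ?_
  rintro P ⟨⟨⟨h0, hdir⟩, _⟩, _, hn⟩
  rw [Finset.mem_coe, Finset.mem_powerset]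
  intro c hc
  obtain ⟨h1, h2, Q, hQ, hcard, _⟩ := exists_subset_of_reachable P (h0 ⟨c, hc⟩) c (hdir c hc)
  have := Finset.card_le_card hQ
  simp only [Finset.mem_product, Finset.mem_Icc]
  omega

/-- `t d n` is the sum of the total internal path lengths of all `d`-restricted directed
column-convex polyominoes of area `n`. -/
noncomputable def t (d n : ℕ) : ℕ :=
  ∑ P ∈ (restrictedDccp_finite d n).toFinset, tipl P

/-- The numerator. -/
noncomputable def f (d : ℕ) : ℚ[X] :=
  -C ((d : ℚ) ^ 2 + 7 * d + 18) * X ^ (d + 3)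
    + 2 * C (2 * (d : ℚ) ^ 2 + 10 * d + 13) * X ^ (d + 4)
    - 2 * C (3 * (d : ℚ) ^ 2 + 9 * d + 11) * X ^ (d + 5)
    + 4 * C ((d : ℚ) ^ 2 + d + 2) * X ^ (d + 6)
    - C ((d : ℚ) ^ 2 - 3 * d - 10) * X ^ (2 * d + 4)
    + C (2 * (d : ℚ) ^ 2 - 4 * d - 6) * X ^ (2 * d + 5)
    + 6 * X ^ (d + 2)
    - C (((d : ℚ) - 1) * d) * X ^ (d + 7)
    - 6 * X ^ (2 * d + 3)
    - C (((d : ℚ) - 1) * d) * X ^ (2 * d + 6)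
    + 2 * X ^ (3 * d + 4)
    - 6 * X ^ 7 + 22 * X ^ 6 - 30 * X ^ 5 + 20 * X ^ 4 - 10 * X ^ 3 + 6 * X ^ 2 - 2 * X

/-- The denominator. -/
noncomputable def g (d : ℕ) : ℚ[X] :=
  2 * ((X - 1) ^ 3 - (X - 1) * X ^ (d + 1)) ^ 3

end Dccp

/-!
In a directed polyomino every north-east path from the origin to the cell `(i, y)` has `i + y + 1`
cells, and no shorter path exists, because a step changes `i + y` by at most one. Hence internal
path lengths do not depend on the shape of the polyomino around the cell.

A polyomino with at least two columns is determined by the height `h` of its first column, the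
initial altitude `s < h` of its second column, and the polyomino `Q` formed by its other columns.
The total internal path lengths of the pieces add up, except that each cell of `Q` gains `s + 1`.
Summing over `h` and `s` gives linear equations for the generating functions of the number, the
area and the total internal path length. Since the first step of the initial altitude is
unrestricted while the first step of `Q` is not, the lower bound `e` of that step is kept apart from
`d`: the equations for `e = d` are self-referential, with `(1 - x) ^ 2 - x ^ (d + 1)` as the
coefficient to be inverted, and the case `e = 0` of the theorem is then read off from them.
-/

namespace Dccp

section Directed

variable {P : Finset Cell}

theorem NEStep.sum_eq {a b : Cell} (h : NEStep P a b) : b.1 + b.2 = a.1 + a.2 + 1 := by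
  obtain ⟨-, -, rfl | rfl⟩ := h
  · exact add_right_comm _ _ _
  · exact (add_assoc _ _ _).symm

theorem IsDirected.induction (hP : IsDirected P) {p : ℤ → ℤ → Prop}
    (origin : (0, 0) ∈ P → p 0 0)
    (east : ∀ i y, (i, y) ∈ P → (i + 1, y) ∈ P → p i y → p (i + 1) y)
    (north : ∀ i y, (i, y) ∈ P → (i, y + 1) ∈ P → p i y → p i (y + 1))
    {i y : ℤ} (h : (i, y) ∈ P) : p i y := by
  suffices ∀ c, Relation.ReflTransGen (NEStep P) (0, 0) c → p c.1 c.2 from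
    this _ (hP.2 _ h)
  intro c hc
  induction hc with
  | refl => exact origin (hP.1 ⟨_, h⟩)
  | tail _ hstep ih =>
    obtain ⟨hb, hc, rfl | rfl⟩ := hstep
    · exact east _ _ hb hc ih
    · exact north _ _ hb hc ih

theorem IsDirected.nonneg (hP : IsDirected P) {i y : ℤ} (h : (i, y) ∈ P) : 0 ≤ i ∧ 0 ≤ y :=
  hP.induction (p := fun i y => 0 ≤ i ∧ 0 ≤ y) (fun _ => by simp)
    (fun _ _ _ _ _ => by omega) (fun _ _ _ _ _ => by omega) h

theorem isDirected_iff : IsDirected P ↔ ∀ i y, (i, y) ∈ P →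
    0 ≤ i ∧ 0 ≤ y ∧ ((i = 0 ∧ y = 0) ∨ (i - 1, y) ∈ P ∨ (i, y - 1) ∈ P) := by
  constructor
  · intro hP i y h
    refine ⟨(hP.nonneg h).1, (hP.nonneg h).2, ?_⟩
    refine hP.induction (p := fun i y => (i = 0 ∧ y = 0) ∨ (i - 1, y) ∈ P ∨ (i, y - 1) ∈ P)
      (fun _ => by simp) (fun i y hw _ _ => ?_) (fun i y hs _ _ => ?_) h
    · exact Or.inr (Or.inl (by rwa [add_sub_cancel_right]))
    · exact Or.inr (Or.inr (by rwa [add_sub_cancel_right]))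
  · intro hP
    have reachable (n : ℕ) : ∀ i y, (i, y) ∈ P → i + y = n →
        Relation.ReflTransGen (NEStep P) (0, 0) (i, y) := by
      induction n with
      | zero =>
        intro i y h hn
        obtain ⟨hi, hy, -⟩ := hP i y h
        obtain ⟨rfl, rfl⟩ : i = 0 ∧ y = 0 := by omega
        exact .refl
      | succ n ih =>
        intro i y h hn
        obtain ⟨-, -, ⟨rfl, rfl⟩ | hw | hs⟩ := hP i y h
        · exact .refl
        · exact (ih _ _ hw (by omega)).tail ⟨hw, h, Or.inl (by simp)⟩
        · exact (ih _ _ hs (by omega)).tail ⟨hs, h, Or.inr (by simp)⟩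
    have reachable_of_mem (c : Cell) (hc : c ∈ P) :
        Relation.ReflTransGen (NEStep P) (0, 0) c := by
      obtain ⟨hi, hy, -⟩ := hP c.1 c.2 hc
      exact reachable (c.1 + c.2).toNat c.1 c.2 hc (by omega)
    refine ⟨fun ⟨c, hc⟩ => ?_, reachable_of_mem⟩
    rcases (reachable_of_mem c hc).cases_head with rfl | ⟨b, hb, -⟩
    exacts [hc, hb.1]

theorem IsDirected.exists_mem_of_le (hP : IsDirected P) {i j y : ℤ} (h : (i, y) ∈ P)
    (hj : 0 ≤ j) (hji : j ≤ i) : ∃ z, (j, z) ∈ P := by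
  refine hP.induction (p := fun i _ => j ≤ i → ∃ z, (j, z) ∈ P) (fun h0 hle => ?_)
    (fun i y _ h ih hle => ?_) (fun _ _ _ _ ih => ih) h hji
  · obtain rfl : j = 0 := by omega
    exact ⟨0, h0⟩
  · rcases hle.eq_or_lt with rfl | hlt
    exacts [⟨y, h⟩, ih (by omega)]

end Directed

section InternalPathLength

variable {P : Finset Cell}

theorem cellGraph_adj_iff {a b : Cell} :
    (cellGraph P).Adj a b ↔ NEStep P a b ∨ NEStep P b a := by
  rw [cellGraph, SimpleGraph.fromRel_adj, and_iff_right_iff_imp]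
  rintro (h | h) rfl <;> have := h.sum_eq <;> omega

theorem sub_le_walk_length {a b : Cell} (w : (cellGraph P).Walk a b) :
    b.1 + b.2 - (a.1 + a.2) ≤ w.length := by
  induction w with
  | nil => simp
  | cons hadj w ih =>
    rw [SimpleGraph.Walk.length_cons]
    rcases cellGraph_adj_iff.1 hadj with h | h <;> have := h.sum_eq <;> omega

theorem exists_walk_length_eq_of_reflTransGen {a c : Cell}
    (h : Relation.ReflTransGen (NEStep P) a c) :
    ∃ w : (cellGraph P).Walk a c, (w.length : ℤ) = c.1 + c.2 - (a.1 + a.2) := by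
  induction h with
  | refl => exact ⟨.nil, by simp⟩
  | tail _ hstep ih =>
    obtain ⟨w, hw⟩ := ih
    refine ⟨w.concat (cellGraph_adj_iff.2 (Or.inl hstep)), ?_⟩
    rw [SimpleGraph.Walk.length_concat, hstep.sum_eq]
    omega

theorem IsDirected.ipl_eq (hP : IsDirected P) {c : Cell} (hc : c ∈ P) :
    (ipl P c : ℤ) = c.1 + c.2 + 1 := by
  obtain ⟨w, hw⟩ := exists_walk_length_eq_of_reflTransGen (hP.2 c hc)
  obtain ⟨v, hv⟩ := w.reachable.exists_walk_length_eq_dist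
  have upper := SimpleGraph.dist_le w
  have lower := sub_le_walk_length v
  rw [ipl]
  omega

theorem IsDirected.tipl_eq (hP : IsDirected P) :
    (tipl P : ℤ) = ∑ c ∈ P, (c.1 + c.2 + 1) := by
  rw [tipl, Nat.cast_sum]
  exact Finset.sum_congr rfl fun c hc => hP.ipl_eq hc

end InternalPathLength

section Gluing

/-- The polyomino with a single column, of height `h`. -/
def column (h : ℕ) : Finset Cell :=
  (Finset.range h).map (Nat.castEmbedding.trans (.sectR 0 ℤ))

/-- The polyomino `Q`, moved one column to the right and `s` cells up, with a column of height `h`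
placed to its left. For `s < h` this is how a polyomino with several columns arises from the
polyomino formed by all its columns but the first. -/
def glue (h s : ℕ) (Q : Finset Cell) : Finset Cell :=
  column h ∪ Q.map (addRightEmbedding (1, (s : ℤ)))

/-- The columns of `P` other than the first one, moved one column to the left and `s` cells
down. -/
def tail (s : ℕ) (P : Finset Cell) : Finset Cell :=
  {c ∈ P | 1 ≤ c.1}.map (addRightEmbedding (-(1, (s : ℤ))))

variable {h s : ℕ} {P Q : Finset Cell} {i y : ℤ}

theorem mem_map_addRightEmbedding {G : Type*} [AddGroup G] {S : Finset G} {a x : G} :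
    x ∈ S.map (addRightEmbedding a) ↔ x - a ∈ S := by
  simp [sub_eq_add_neg, ← eq_add_neg_iff_add_eq]

theorem mem_column : (i, y) ∈ column h ↔ i = 0 ∧ 0 ≤ y ∧ y < h := by
  simp only [column, Finset.mem_map, Finset.mem_range, Function.Embedding.trans_apply,
    Nat.castEmbedding_apply, Function.Embedding.sectR_apply, Prod.mk.injEq]
  constructor
  · rintro ⟨z, hz, rfl, rfl⟩
    omega
  · rintro ⟨rfl, hy⟩
    exact ⟨y.toNat, by omega⟩

theorem mem_glue : (i, y) ∈ glue h s Q ↔ (i = 0 ∧ 0 ≤ y ∧ y < h) ∨ (i - 1, y - s) ∈ Q := by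
  rw [glue, Finset.mem_union, mem_column, mem_map_addRightEmbedding, Prod.mk_sub_mk]

theorem mem_tail : (i, y) ∈ tail s P ↔ 0 ≤ i ∧ (i + 1, y + s) ∈ P := by
  rw [tail, mem_map_addRightEmbedding, sub_neg_eq_add, Finset.mem_filter, and_comm]
  simp

theorem mem_glue_zero (hQ : IsDirected Q) : (0, y) ∈ glue h s Q ↔ 0 ≤ y ∧ y < h := by
  have hneg : (0 - 1, y - s) ∉ Q := fun hc => by have := hQ.nonneg hc; omega
  rw [mem_glue, or_iff_left hneg, and_iff_right rfl]

theorem mem_glue_of_pos (hi : 1 ≤ i) : (i, y) ∈ glue h s Q ↔ (i - 1, y - s) ∈ Q := by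
  rw [mem_glue, or_iff_right]
  omega

theorem tail_glue (hQ : IsDirected Q) : tail s (glue h s Q) = Q := by
  ext ⟨i, y⟩
  rw [mem_tail, mem_glue]
  constructor
  · rintro ⟨hi, hcol | hQ⟩
    · omega
    · simpa using hQ
  · intro hc
    exact ⟨(hQ.nonneg hc).1, Or.inr (by simpa using hc)⟩

theorem glue_nonempty (hh : 0 < h) : (glue h s Q).Nonempty :=
  ⟨(0, 0), mem_glue.2 (Or.inl ⟨rfl, le_rfl, by omega⟩)⟩

theorem glue_ne_column {n : ℕ} (hQ : IsDirected Q) (hne : Q.Nonempty) :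
    glue h s Q ≠ column n := by
  intro heq
  have hmem : ((1, s) : Cell) ∈ glue h s Q :=
    (mem_glue_of_pos le_rfl).2 (by simpa using hQ.1 hne)
  rw [heq, mem_column] at hmem
  omega

theorem isDccp_column (h : ℕ) : IsDccp (column h) := by
  constructor
  · rw [isDirected_iff]
    intro i y
    simp only [mem_column]
    omega
  · intro i y₁ y y₂
    simp only [mem_column]
    omega

theorem isDccp_glue (hs : s < h) (hQ : IsDccp Q) : IsDccp (glue h s Q) := by
  obtain ⟨hdir, hconv⟩ := hQ
  constructor
  · rw [isDirected_iff]
    intro i y hc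
    simp only [mem_glue] at hc ⊢
    rcases hc with hc | hc
    · omega
    · obtain ⟨hi, hy, h0 | hw | hs'⟩ := isDirected_iff.1 hdir _ _ hc
      · omega
      · exact ⟨by omega, by omega, Or.inr (Or.inl (Or.inr hw))⟩
      · exact ⟨by omega, by omega, Or.inr (Or.inr (Or.inr (by rwa [sub_right_comm])))⟩
  · intro i y₁ y y₂ h₁ h₂ hle₁ hle₂
    rw [mem_glue] at *
    rcases h₁ with h₁ | h₁ <;> rcases h₂ with h₂ | h₂
    · omega
    · have := hdir.nonneg h₂
      omega
    · have := hdir.nonneg h₁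
      omega
    · exact Or.inr (hconv _ _ _ _ h₁ h₂ (by omega) (by omega))

theorem disjoint_column_map (hQ : IsDirected Q) :
    Disjoint (column h) (Q.map (addRightEmbedding (1, (s : ℤ)))) := by
  rw [Finset.disjoint_left]
  rintro ⟨i, y⟩ hcol hmap
  rw [mem_column] at hcol
  rw [mem_map_addRightEmbedding, Prod.mk_sub_mk] at hmap
  have := hQ.nonneg hmap
  omega

theorem card_column (h : ℕ) : (column h).card = h := by
  rw [column, Finset.card_map, Finset.card_range]

theorem card_glue (hQ : IsDirected Q) : (glue h s Q).card = h + Q.card := by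
  rw [glue, Finset.card_union_of_disjoint (disjoint_column_map hQ), card_column,
    Finset.card_map]

theorem tipl_column (h : ℕ) : tipl (column h) = (h + 1).choose 2 := by
  zify
  rw [(isDccp_column h).1.tipl_eq, column, Finset.sum_map]
  induction h with
  | zero => simp
  | succ n ih =>
    rw [Finset.sum_range_succ, ih, Nat.choose_succ_succ' (n + 1) 1, Nat.choose_one_right]
    simp [add_comm]

theorem tipl_glue (hs : s < h) (hQ : IsDccp Q) :
    tipl (glue h s Q) = (h + 1).choose 2 + tipl Q + (s + 1) * Q.card := by
  have shifted : ∑ c ∈ Q.map (addRightEmbedding (1, (s : ℤ))), (c.1 + c.2 + 1) =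
      tipl Q + (s + 1) * Q.card := by
    rw [hQ.1.tipl_eq, Finset.sum_map, mul_comm, ← nsmul_eq_mul, ← Finset.sum_const,
      ← Finset.sum_add_distrib]
    refine Finset.sum_congr rfl fun c _ => ?_
    simp only [addRightEmbedding_apply, Prod.fst_add, Prod.snd_add]
    ring
  zify
  rw [(isDccp_glue hs hQ).1.tipl_eq, glue, Finset.sum_union (disjoint_column_map hQ.1), shifted,
    ← (isDccp_column h).1.tipl_eq, tipl_column]
  ring

end Gluing

section InitialAltitude

variable {P Q : Finset Cell} {d e h s : ℕ} {i a : ℤ}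

theorem IsDirected.isInitialAltitude_zero_iff (hP : IsDirected P) (hne : P.Nonempty) :
    IsInitialAltitude P 0 a ↔ a = 0 := by
  have h0 : IsInitialAltitude P 0 0 := ⟨hP.1 hne, fun _ hy => (hP.nonneg hy).2⟩
  exact ⟨fun ha => ha.unique h0, fun ha => ha ▸ h0⟩

theorem IsDirected.exists_isInitialAltitude (hP : IsDirected P) {y : ℤ} (h : (i, y) ∈ P) :
    ∃ a, IsInitialAltitude P i a := by
  obtain ⟨a, ha, hmin⟩ := Int.exists_least_of_bdd (P := fun y => (i, y) ∈ P)
    ⟨0, fun _ hz => (hP.nonneg hz).2⟩ ⟨y, h⟩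
  exact ⟨a, ha, hmin⟩

theorem isInitialAltitude_glue (hi : 1 ≤ i) :
    IsInitialAltitude (glue h s Q) i a ↔ IsInitialAltitude Q (i - 1) (a - s) := by
  simp only [IsInitialAltitude, IsLeast, mem_lowerBounds, Set.mem_ofPred_eq, mem_glue_of_pos hi]
  refine and_congr_right fun _ => ⟨fun hmin y hy => ?_, fun hmin y hy => ?_⟩
  · have := hmin (y + s) (by simpa using hy)
    omega
  · have := hmin _ hy
    omega

theorem isInitialAltitude_glue_one (hQ : IsDirected Q) (hne : Q.Nonempty) :
    IsInitialAltitude (glue h s Q) 1 a ↔ a = s := by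
  rw [isInitialAltitude_glue le_rfl, sub_self, hQ.isInitialAltitude_zero_iff hne, sub_eq_zero]

theorem eq_and_eq_and_eq_of_glue_eq_glue {h' s' : ℕ} {Q' : Finset Cell} (hQ : IsDirected Q)
    (hne : Q.Nonempty) (hQ' : IsDirected Q') (hne' : Q'.Nonempty)
    (heq : glue h s Q = glue h' s' Q') : h = h' ∧ s = s' ∧ Q = Q' := by
  have heights (y : ℤ) : (0 ≤ y ∧ y < h) ↔ (0 ≤ y ∧ y < h') := by
    rw [← mem_glue_zero hQ (s := s), heq, mem_glue_zero hQ']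
  obtain rfl : h = h' := by
    have := heights h
    have := heights h'
    omega
  obtain rfl : s = s' := by
    have altitude := (isInitialAltitude_glue_one (h := h) (s := s) hQ hne).2 rfl
    rw [heq, isInitialAltitude_glue_one hQ' hne'] at altitude
    exact_mod_cast altitude
  exact ⟨rfl, rfl, by rw [← tail_glue (h := h) (s := s) hQ, heq, tail_glue hQ']⟩

/-- The initial altitude grows by at least `e` from the first column to the second one, and by at
least `d` from every other column to the next one. Separating the first step makes the notion
recursive: removing the first column replaces `e` by `d`. -/
def HasAltitudeSteps (e d : ℕ) (P : Finset Cell) : Prop :=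
  (∀ a b : ℤ, IsInitialAltitude P 0 a → IsInitialAltitude P 1 b → (e : ℤ) ≤ b - a) ∧
    ∀ i a b : ℤ, 1 ≤ i → IsInitialAltitude P i a → IsInitialAltitude P (i + 1) b →
      (d : ℤ) ≤ b - a

theorem hasAltitudeSteps_column : HasAltitudeSteps e d (column h) := by
  constructor
  · rintro a b - ⟨hb, -⟩
    have := (mem_column.1 hb).1
    omega
  · rintro i a b hi ⟨ha, -⟩
    have := (mem_column.1 ha).1
    omega

theorem hasAltitudeSteps_self_iff : HasAltitudeSteps d d P ↔
    ∀ i a b : ℤ, 0 ≤ i → IsInitialAltitude P i a → IsInitialAltitude P (i + 1) b →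
      (d : ℤ) ≤ b - a := by
  refine ⟨fun ⟨first, later⟩ i a b hi => ?_, fun H => ⟨fun a b => H 0 a b le_rfl, ?_⟩⟩
  · rcases hi.eq_or_lt with rfl | hi
    exacts [first a b, later i a b hi]
  · exact fun i a b hi => H i a b (by omega)

theorem hasAltitudeSteps_glue (hs : s < h) (hQ : IsDccp Q) (hne : Q.Nonempty) :
    HasAltitudeSteps e d (glue h s Q) ↔ e ≤ s ∧ HasAltitudeSteps d d Q := by
  rw [HasAltitudeSteps, hasAltitudeSteps_self_iff]
  refine and_congr ?_ ⟨fun H i a b hi ha hb => ?_, fun H i a b hi ha hb => ?_⟩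
  · simp [(isDccp_glue hs hQ).1.isInitialAltitude_zero_iff (glue_nonempty (by omega)),
      isInitialAltitude_glue_one hQ.1 hne]
  · have := H (i + 1) (a + s) (b + s) (by omega)
      ((isInitialAltitude_glue (by omega)).2 (by simpa using ha))
      ((isInitialAltitude_glue (by omega)).2 (by simpa using hb))
    omega
  · have := H (i - 1) (a - s) (b - s) (by omega) ((isInitialAltitude_glue hi).1 ha)
      (by simpa using (isInitialAltitude_glue (by omega)).1 hb)
    omega

theorem IsDirected.three_le_card_image_fst (hP : IsDirected P) {y : ℤ} (hi : 2 ≤ i)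
    (h : (i, y) ∈ P) : 3 ≤ (P.image Prod.fst).card := by
  have columns : Finset.Icc 0 2 ⊆ P.image Prod.fst := fun j hj => by
    rw [Finset.mem_Icc] at hj
    obtain ⟨z, hz⟩ := hP.exists_mem_of_le h hj.1 (by omega)
    exact Finset.mem_image_of_mem Prod.fst hz
  simpa using Finset.card_le_card columns

theorem IsDirected.isRestricted_iff (hP : IsDirected P) :
    IsRestricted d P ↔ HasAltitudeSteps 0 d P := by
  refine ⟨fun H => ⟨fun a b ha hb => ?_, ?_⟩, fun H => Or.inr H.2⟩
  · rw [hP.isInitialAltitude_zero_iff ⟨_, ha.1⟩] at ha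
    simpa [ha] using (hP.nonneg hb.1).2
  · rcases H with few_columns | H
    · intro i a b hi _ hb
      have := hP.three_le_card_image_fst (by omega) hb.1
      omega
    · exact H

end InitialAltitude

section Decomposition

variable {P : Finset Cell}

theorem IsDccp.exists_height (hP : IsDccp P) (hne : P.Nonempty) :
    ∃ h : ℕ, ∀ y : ℤ, (0, y) ∈ P ↔ 0 ≤ y ∧ y < h := by
  have origin := hP.1.1 hne
  have top_nonempty : {c ∈ P | c.1 = 0}.Nonempty :=
    ⟨(0, 0), Finset.mem_filter.2 ⟨origin, rfl⟩⟩
  obtain ⟨⟨i, b⟩, hb, hmax⟩ := Finset.exists_max_image {c ∈ P | c.1 = 0} Prod.snd top_nonempty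
  obtain ⟨hb, rfl : i = 0⟩ := Finset.mem_filter.1 hb
  have hb0 := (hP.1.nonneg hb).2
  refine ⟨(b + 1).toNat, fun y => ⟨fun hy => ?_, fun hy => ?_⟩⟩
  · have : y ≤ b := hmax (0, y) (Finset.mem_filter.2 ⟨hy, rfl⟩)
    have := (hP.1.nonneg hy).2
    omega
  · exact hP.2 0 0 y b origin hb hy.1 (by omega)

theorem IsDccp.eq_column {h : ℕ} (hP : IsDccp P) (height : ∀ y : ℤ, (0, y) ∈ P ↔ 0 ≤ y ∧ y < h)
    (hone : ∀ y, (1, y) ∉ P) : P = column h := by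
  ext ⟨i, y⟩
  rw [mem_column]
  constructor
  · intro hc
    obtain ⟨hi, -⟩ := hP.1.nonneg hc
    obtain rfl : i = 0 := by
      by_contra hi0
      obtain ⟨z, hz⟩ := hP.1.exists_mem_of_le hc zero_le_one (by omega)
      exact hone z hz
    exact ⟨rfl, (height y).1 hc⟩
  · rintro ⟨rfl, hy⟩
    exact (height y).2 hy

theorem IsDirected.initialAltitude_one_le {s : ℤ} (hP : IsDirected P)
    (hs : IsInitialAltitude P 1 s) {i y : ℤ} (h : (i, y) ∈ P) (hi : 1 ≤ i) : s ≤ y := by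
  refine hP.induction (p := fun i y => 1 ≤ i → s ≤ y) (fun _ hi => by omega)
    (fun i y _ h ih hi => ?_) (fun i y _ _ ih hi => by have := ih hi; omega) h hi
  rcases hi.eq_or_lt with hi | hi
  · rw [← hi] at h
    exact hs.2 h
  · exact ih (by omega)

theorem isDccp_tail {s : ℕ} (hP : IsDccp P) (hs : IsInitialAltitude P 1 s) :
    IsDccp (tail s P) := by
  constructor
  · rw [isDirected_iff]
    intro i y
    simp only [mem_tail]
    rintro ⟨hi, hc⟩
    have hsy := hP.1.initialAltitude_one_le hs hc (by omega)
    refine ⟨hi, by omega, ?_⟩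
    rcases hi.eq_or_lt with rfl | hi
    · rcases hsy.eq_or_lt with hsy | hsy
      · omega
      · exact Or.inr (Or.inr ⟨le_rfl, hP.2 _ _ _ _ hs.1 hc (by omega) (by omega)⟩)
    · obtain ⟨-, -, h0 | hw | hs'⟩ := isDirected_iff.1 hP.1 _ _ hc
      · omega
      · exact Or.inr (Or.inl ⟨by omega, by rwa [sub_add_eq_add_sub]⟩)
      · exact Or.inr (Or.inr ⟨hi.le, by rwa [sub_add_eq_add_sub]⟩)
  · intro i y₁ y y₂
    simp only [mem_tail]
    exact fun h₁ h₂ hle₁ hle₂ =>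
      ⟨h₁.1, hP.2 _ _ _ _ h₁.2 h₂.2 (by omega) (by omega)⟩

theorem IsDirected.glue_tail {h s : ℕ} (hP : IsDirected P)
    (height : ∀ y : ℤ, (0, y) ∈ P ↔ 0 ≤ y ∧ y < h) : glue h s (tail s P) = P := by
  ext ⟨i, y⟩
  rw [mem_glue, mem_tail, sub_add_cancel, sub_add_cancel]
  constructor
  · rintro (⟨rfl, hy⟩ | ⟨-, hc⟩)
    exacts [(height y).2 hy, hc]
  · intro hc
    rcases (hP.nonneg hc).1.eq_or_lt with rfl | hi
    · exact Or.inl ⟨rfl, (height y).1 hc⟩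
    · exact Or.inr ⟨by omega, hc⟩

theorem IsDccp.eq_column_or_eq_glue (hP : IsDccp P) (hne : P.Nonempty) :
    (∃ h, P = column h) ∨ ∃ h s Q, s < h ∧ IsDccp Q ∧ Q.Nonempty ∧ P = glue h s Q := by
  obtain ⟨h, height⟩ := hP.exists_height hne
  by_cases hone : ∃ y, (1, y) ∈ P
  · obtain ⟨y, hy⟩ := hone
    obtain ⟨a, ha⟩ := hP.1.exists_isInitialAltitude hy
    obtain ⟨s, rfl⟩ := Int.eq_ofNat_of_zero_le (hP.1.nonneg ha.1).2
    have below_height : s < h := by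
      -- the lowest cell of the second column can only be entered from the first column
      obtain ⟨-, -, h0 | hw | hs⟩ := isDirected_iff.1 hP.1 _ _ ha.1
      · omega
      · have := (height s).1 (by simpa using hw)
        omega
      · have := ha.2 hs
        omega
    exact Or.inr ⟨h, s, tail s P, below_height, isDccp_tail hP ha,
      ⟨(0, 0), mem_tail.2 ⟨le_rfl, by simpa using ha.1⟩⟩, (hP.1.glue_tail height).symm⟩
  · exact Or.inl ⟨h, hP.eq_column height (not_exists.1 hone)⟩

end Decomposition

section Enumeration

open Finset

open Classical in
/-- The nonempty directed column-convex polyominoes of area `n` whose initial altitude grows by at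
least `e` from the first column to the second one, and by at least `d` from then on. -/
noncomputable def steppedDccp (e d n : ℕ) : Finset (Finset Cell) :=
  {P ∈ (restrictedDccp_finite d n).toFinset | P.Nonempty ∧ HasAltitudeSteps e d P}

variable {d e n : ℕ} {P : Finset Cell}

theorem mem_steppedDccp :
    P ∈ steppedDccp e d n ↔ IsDccp P ∧ P.Nonempty ∧ HasAltitudeSteps e d P ∧ #P = n := by
  simp only [steppedDccp, mem_filter, Set.Finite.mem_toFinset, restrictedDccp,
    Set.mem_ofPred_eq]
  refine ⟨fun ⟨⟨hP, _, hn⟩, hne, hsteps⟩ => ⟨hP, hne, hsteps, hn⟩,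
    fun ⟨hP, hne, hsteps, hn⟩ => ⟨⟨hP, Or.inr hsteps.2, hn⟩, hne, hsteps⟩⟩

theorem steppedDccp_zero : steppedDccp e d 0 = ∅ := by
  ext P
  simp only [mem_steppedDccp, card_eq_zero, notMem_empty, iff_false]
  rintro ⟨-, hne, -, rfl⟩
  exact hne.ne_empty rfl

theorem t_eq_sum_steppedDccp (d n : ℕ) : t d n = ∑ P ∈ steppedDccp 0 d n, tipl P := by
  classical
  rw [t, steppedDccp, sum_filter_of_ne]
  intro P hP htipl
  obtain ⟨hdccp, hrestr, -⟩ := (restrictedDccp_finite d n).mem_toFinset.1 hP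
  refine ⟨nonempty_iff_ne_empty.2 ?_, hdccp.1.isRestricted_iff.1 hrestr⟩
  rintro rfl
  exact htipl sum_empty

/-- The possible ways of building a polyomino of `steppedDccp e d n` with at least two columns:
the height of its first column and the area of the rest, the initial altitude of its second
column, and the rest. -/
noncomputable def gluingData (e d n : ℕ) : Finset ((_ : ℕ × ℕ) × ℕ × Finset Cell) :=
  (antidiagonal n).sigma fun p => Ico e p.1 ×ˢ steppedDccp d d p.2

theorem steppedDccp_eq_insert_column (hn : 0 < n) : steppedDccp e d n =
    insert (column n) ((gluingData e d n).image fun x => glue x.1.1 x.2.1 x.2.2) := by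
  ext P
  simp only [mem_insert, mem_image, gluingData, mem_sigma, mem_product,
    HasAntidiagonal.mem_antidiagonal, mem_Ico, mem_steppedDccp]
  constructor
  · rintro ⟨hP, hne, hsteps, rfl⟩
    rcases hP.eq_column_or_eq_glue hne with ⟨h, rfl⟩ | ⟨h, s, Q, hs, hQ, hneQ, rfl⟩
    · exact Or.inl (by rw [card_column])
    · obtain ⟨hes, hstepsQ⟩ := (hasAltitudeSteps_glue hs hQ hneQ).1 hsteps
      exact Or.inr ⟨⟨(h, #Q), s, Q⟩, ⟨(card_glue hQ.1).symm, ⟨hes, hs⟩, hQ, hneQ, hstepsQ, rfl⟩,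
        rfl⟩
  · rintro (rfl | ⟨⟨⟨h, m⟩, s, Q⟩, ⟨hn, ⟨hes, hs⟩, hQ, hneQ, hstepsQ, hm⟩, rfl⟩)
    · exact ⟨isDccp_column n, card_pos.1 (by rwa [card_column]), hasAltitudeSteps_column,
        card_column n⟩
    · exact ⟨isDccp_glue hs hQ, glue_nonempty (by omega),
        (hasAltitudeSteps_glue hs hQ hneQ).2 ⟨hes, hstepsQ⟩, by rw [card_glue hQ.1, hm, hn]⟩

theorem sum_steppedDccp {M : Type*} [AddCommMonoid M] (hn : 0 < n) (φ : Finset Cell → M) :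
    ∑ P ∈ steppedDccp e d n, φ P = φ (column n) + ∑ p ∈ antidiagonal n,
      ∑ s ∈ Ico e p.1, ∑ Q ∈ steppedDccp d d p.2, φ (glue p.1 s Q) := by
  have rest {x} (hx : x ∈ gluingData e d n) :
      IsDirected x.2.2 ∧ x.2.2.Nonempty ∧ #x.2.2 = x.1.2 := by
    simp only [gluingData, mem_sigma, mem_product, mem_steppedDccp] at hx
    exact ⟨hx.2.2.1.1, hx.2.2.2.1, hx.2.2.2.2.2⟩
  rw [steppedDccp_eq_insert_column hn, sum_insert, sum_image]
  · simp only [gluingData, sum_sigma, sum_product]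
  · rintro ⟨⟨h, m⟩, s, Q⟩ hx ⟨⟨h', m'⟩, s', Q'⟩ hx' heq
    obtain ⟨hQ, hne, hm : #Q = m⟩ := rest hx
    obtain ⟨hQ', hne', hm' : #Q' = m'⟩ := rest hx'
    obtain ⟨rfl, rfl, rfl⟩ := eq_and_eq_and_eq_of_glue_eq_glue hQ hne hQ' hne' heq
    rw [← hm, ← hm']
  · rw [mem_image]
    rintro ⟨x, hx, heq⟩
    exact glue_ne_column (rest hx).1 (rest hx).2.1 heq

end Enumeration

local notation "𝐱" => PowerSeries.X

section GeneratingFunctions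

open Finset
open scoped PowerSeries

variable {R : Type*} [CommSemiring R] {d e : ℕ}

/-- The generating function by area of the polyominoes of `steppedDccp e d`, each of them counted
with the weight `φ`. -/
noncomputable def genFun (e d : ℕ) (φ : Finset Cell → R) : R⟦X⟧ :=
  PowerSeries.mk fun n => ∑ P ∈ steppedDccp e d n, φ P

/-- The part of a generating function that comes from the polyominoes `glue h s Q` with at least
two columns; the weight `Φ h s Q` is a function of the pieces. -/
noncomputable def gluedGenFun (e d : ℕ) (Φ : ℕ → ℕ → Finset Cell → R) : R⟦X⟧ :=
  PowerSeries.mk fun n =>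
    ∑ p ∈ antidiagonal n, ∑ s ∈ Ico e p.1, ∑ Q ∈ steppedDccp d d p.2, Φ p.1 s Q

theorem genFun_eq_add_gluedGenFun (φ : Finset Cell → R) :
    genFun e d φ = 𝐱 * PowerSeries.mk (fun n => φ (column (n + 1)))
      + gluedGenFun e d fun h s Q => φ (glue h s Q) := by
  ext n
  rw [genFun, gluedGenFun, map_add, PowerSeries.coeff_mk, PowerSeries.coeff_mk]
  cases n with
  | zero => simp [steppedDccp_zero]
  | succ n => rw [sum_steppedDccp n.succ_pos, PowerSeries.coeff_succ_X_mul, PowerSeries.coeff_mk]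

theorem gluedGenFun_add (Φ Ψ : ℕ → ℕ → Finset Cell → R) :
    gluedGenFun e d (fun h s Q => Φ h s Q + Ψ h s Q) =
      gluedGenFun e d Φ + gluedGenFun e d Ψ := by
  ext n
  simp only [gluedGenFun, map_add, PowerSeries.coeff_mk, sum_add_distrib]

theorem gluedGenFun_mul (a : ℕ → ℕ → R) (ψ : Finset Cell → R) :
    gluedGenFun e d (fun h s Q => a h s * ψ Q) =
      PowerSeries.mk (fun h => ∑ s ∈ Ico e h, a h s) * genFun d d ψ := by
  ext n
  simp only [gluedGenFun, genFun, PowerSeries.coeff_mul, PowerSeries.coeff_mk, sum_mul_sum]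

theorem gluedGenFun_congr {Φ Ψ : ℕ → ℕ → Finset Cell → R}
    (heq : ∀ h s Q, s < h → IsDccp Q → Φ h s Q = Ψ h s Q) :
    gluedGenFun e d Φ = gluedGenFun e d Ψ := by
  ext n
  simp only [gluedGenFun, PowerSeries.coeff_mk]
  exact sum_congr rfl fun p _ => sum_congr rfl fun s hs => sum_congr rfl fun Q hQ =>
    heq p.1 s Q (mem_Ico.1 hs).2 (mem_steppedDccp.1 hQ).1

theorem genFun_card : genFun e d (fun P => (#P : R)) = 𝐱 * d⁄dX R (genFun e d 1) := by
  ext n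
  have card_eq : ∑ P ∈ steppedDccp e d n, (#P : R) = #(steppedDccp e d n) * n := by
    rw [← nsmul_eq_mul, ← sum_const]
    exact sum_congr rfl fun P hP => by rw [(mem_steppedDccp.1 hP).2.2.2]
  rw [genFun, PowerSeries.coeff_mk, card_eq]
  cases n with
  | zero => simp
  | succ n => simp [genFun, PowerSeries.coeff_succ_X_mul, PowerSeries.coeff_derivative]

theorem genFun_one : genFun e d (1 : Finset Cell → R) =
    𝐱 * PowerSeries.mk 1 + PowerSeries.mk (fun h => ((h - e : ℕ) : R)) * genFun d d 1 := by
  have glued : gluedGenFun e d (fun _ _ _ => (1 : R)) =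
      PowerSeries.mk (fun h => ((h - e : ℕ) : R)) * genFun d d 1 := by
    simpa using gluedGenFun_mul (e := e) (d := d) (fun _ _ => (1 : R)) 1
  rw [genFun_eq_add_gluedGenFun, ← glued]
  rfl

theorem genFun_tipl : genFun e d (fun P => (tipl P : R)) =
    𝐱 * PowerSeries.mk (fun n => ((n + 2).choose 2 : R))
      + PowerSeries.mk (fun h => (((h - e) * (h + 1).choose 2 : ℕ) : R)) * genFun d d 1
      + PowerSeries.mk (fun h => ((h - e : ℕ) : R)) * genFun d d (fun Q => (tipl Q : R))
      + PowerSeries.mk (fun h => ∑ s ∈ Ico e h, (s + 1 : R)) * (𝐱 * d⁄dX R (genFun d d 1)) := by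
  have glued : gluedGenFun e d (fun h s Q => (tipl (glue h s Q) : R)) =
      gluedGenFun e d fun h s Q => ((h + 1).choose 2 : R) * (1 : Finset Cell → R) Q +
        1 * (tipl Q : R) + (s + 1 : R) * (#Q : R) :=
    gluedGenFun_congr fun h s Q hs hQ => by simp [tipl_glue hs hQ]
  rw [genFun_eq_add_gluedGenFun, glued, gluedGenFun_add, gluedGenFun_add, gluedGenFun_mul,
    gluedGenFun_mul _ fun Q => (tipl Q : R), gluedGenFun_mul _ fun Q => (#Q : R), genFun_card]
  simp only [tipl_column, sum_const, Nat.card_Ico, nsmul_eq_mul, mul_one, Nat.cast_mul, add_assoc,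
    Nat.reduceAdd]

end GeneratingFunctions

section ColumnSeries

open Finset
open scoped PowerSeries

theorem mk_eq_X_pow_mul {R : Type*} [Semiring R] {a : ℕ → R} {F : R⟦X⟧} (m : ℕ)
    (below : ∀ h < m, a h = 0) (shifted : ∀ j, a (j + m) = PowerSeries.coeff j F) :
    PowerSeries.mk a = 𝐱 ^ m * F := by
  ext h
  rw [PowerSeries.coeff_mk, PowerSeries.coeff_X_pow_mul']
  split_ifs with hm
  · rw [← shifted, Nat.sub_add_cancel hm]
  · exact below h (not_le.1 hm)

variable {R : Type*} [CommRing R]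

theorem mk_choose_two_mul :
    PowerSeries.mk (fun n => ((n + 2).choose 2 : R)) * (1 - 𝐱) ^ 3 = 1 := by
  simpa only [add_comm 2] using PowerSeries.mk_add_choose_mul_one_sub_pow_eq_one R 2

theorem mk_choose_three_mul :
    PowerSeries.mk (fun n => ((n + 3).choose 3 : R)) * (1 - 𝐱) ^ 4 = 1 := by
  simpa only [add_comm 3] using PowerSeries.mk_add_choose_mul_one_sub_pow_eq_one R 3

theorem mk_succ_mul : PowerSeries.mk (fun n => (n + 1 : R)) * (1 - 𝐱) ^ 2 = 1 := by
  simpa [add_comm (1 : R)] using PowerSeries.mk_add_choose_mul_one_sub_pow_eq_one R 1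

theorem mk_sub_mul (e : ℕ) :
    PowerSeries.mk (fun h => ((h - e : ℕ) : R)) * (1 - 𝐱) ^ 2 = 𝐱 ^ (e + 1) := by
  rw [mk_eq_X_pow_mul (F := PowerSeries.mk fun n => (n + 1 : R)) (e + 1), mul_assoc, mk_succ_mul,
    mul_one]
  · intro h hh
    rw [Nat.sub_eq_zero_of_le (by omega), Nat.cast_zero]
  · intro j
    rw [PowerSeries.coeff_mk, show j + (e + 1) - e = j + 1 by omega, Nat.cast_succ]

theorem sum_Ico_add_one (e j : ℕ) :
    ∑ s ∈ Ico e (j + (e + 1)), (s + 1) = (j + 2).choose 2 + e * (j + 1) := by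
  induction j with
  | zero => simp [add_comm]
  | succ j ih =>
    rw [show j + 1 + (e + 1) = j + (e + 1) + 1 by omega, sum_Ico_succ_top (by omega), ih,
      Nat.choose_succ_succ' (j + 2) 1, Nat.choose_one_right]
    ring

theorem mk_sum_Ico_mul (e : ℕ) :
    PowerSeries.mk (fun h => ∑ s ∈ Ico e h, (s + 1 : R)) * (1 - 𝐱) ^ 3 =
      𝐱 ^ (e + 1) * (1 + (e : R⟦X⟧) * (1 - 𝐱)) := by
  rw [mk_eq_X_pow_mul (F := PowerSeries.mk (fun n => ((n + 2).choose 2 : R))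
    + e • PowerSeries.mk fun n => (n + 1 : R)) (e + 1)]
  · rw [nsmul_eq_mul]
    linear_combination 𝐱 ^ (e + 1) * mk_choose_two_mul (R := R)
      + 𝐱 ^ (e + 1) * (e * (1 - 𝐱)) * mk_succ_mul (R := R)
  · intro h hh
    rw [Ico_eq_empty (by omega), sum_empty]
  · intro j
    rw [map_add, map_nsmul, PowerSeries.coeff_mk, PowerSeries.coeff_mk, nsmul_eq_mul]
    exact_mod_cast congrArg (Nat.cast (R := R)) (sum_Ico_add_one e j)

theorem succ_mul_choose_two_add (e j : ℕ) :
    (j + 1) * (j + e + 2).choose 2 + 2 * (j + 2).choose 2 =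
      3 * (j + 3).choose 3 + 2 * e * (j + 2).choose 2 + e.choose 2 * (j + 1) := by
  have choose_three := Nat.add_one_mul_choose_eq (j + 2) 2
  qify at choose_three ⊢
  simp only [Nat.cast_choose_two] at choose_three ⊢
  push_cast at choose_three ⊢
  linear_combination choose_three

/-- The numerator of the generating function of `h ↦ (h - e) * (h + 1).choose 2`, without its
factor `x ^ (e + 1)`: it collects the internal path lengths in the first column over all possible
initial altitudes of the second one. -/
noncomputable def heightNumerator (R : Type*) [CommRing R] (e : ℕ) : R⟦X⟧ :=
  3 + 2 * ((e : R⟦X⟧) - 1) * (1 - 𝐱) + (e.choose 2 : R⟦X⟧) * (1 - 𝐱) ^ 2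

theorem mk_sub_mul_choose_two_mul (e : ℕ) :
    PowerSeries.mk (fun h => (((h - e) * (h + 1).choose 2 : ℕ) : R)) * (1 - 𝐱) ^ 4 =
      𝐱 ^ (e + 1) * heightNumerator R e := by
  rw [mk_eq_X_pow_mul (F := 3 • PowerSeries.mk (fun n => ((n + 3).choose 3 : R))
    + (2 * e : ℕ) • PowerSeries.mk (fun n => ((n + 2).choose 2 : R))
    + e.choose 2 • PowerSeries.mk (fun n => (n + 1 : R))
    - 2 • PowerSeries.mk (fun n => ((n + 2).choose 2 : R))) (e + 1)]
  · rw [heightNumerator]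
    simp only [nsmul_eq_mul, Nat.cast_mul, Nat.cast_ofNat]
    linear_combination 𝐱 ^ (e + 1) * 3 * mk_choose_three_mul (R := R)
      + 𝐱 ^ (e + 1) * (2 * ((e : R⟦X⟧) - 1) * (1 - 𝐱)) * mk_choose_two_mul (R := R)
      + 𝐱 ^ (e + 1) * ((e.choose 2 : ℕ) * (1 - 𝐱) ^ 2) * mk_succ_mul (R := R)
  · intro h hh
    rw [Nat.sub_eq_zero_of_le (by omega), zero_mul, Nat.cast_zero]
  · intro j
    rw [show j + (e + 1) - e = j + 1 by omega, show j + (e + 1) + 1 = j + e + 2 by omega]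
    simp only [map_add, map_sub, map_nsmul, PowerSeries.coeff_mk]
    simp only [nsmul_eq_mul, eq_sub_iff_add_eq]
    exact_mod_cast congrArg (Nat.cast (R := R)) (succ_mul_choose_two_add e j)

end ColumnSeries

section FunctionalEquations

open scoped PowerSeries

variable {R : Type*} [CommRing R]

/-- The kernel `(1 - x) ^ 2 - x ^ (d + 1)` of the functional equations: removing the first column
expresses each generating function of `steppedDccp d d` through itself, and this is the factor by
which the unknown series ends up being multiplied. -/
noncomputable def kernel (R : Type*) [CommRing R] (d : ℕ) : R⟦X⟧ :=
  (1 - 𝐱) ^ 2 - 𝐱 ^ (d + 1)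

variable (R) in
theorem isUnit_one_sub_X : IsUnit (1 - 𝐱 : R⟦X⟧) :=
  .of_mul_eq_one_right _ (PowerSeries.mk_one_mul_one_sub_eq_one R)

theorem kernel_mul_genFun_one (d : ℕ) : kernel R d * genFun d d 1 = 𝐱 * (1 - 𝐱) := by
  rw [kernel]
  linear_combination (1 - 𝐱) ^ 2 * genFun_one (R := R) (d := d) (e := d)
    + 𝐱 * (1 - 𝐱) * PowerSeries.mk_one_mul_one_sub_eq_one R + genFun d d 1 * mk_sub_mul (R := R) d

/-- The numerator of the generating function `x * C'` of the total area, where `C` is the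
generating function of `steppedDccp d d`; its denominator is `kernel R d ^ 2`, up to a factor
`x`. -/
noncomputable def areaNumerator (R : Type*) [CommRing R] (d : ℕ) : R⟦X⟧ :=
  (1 - 𝐱) ^ 2 + 𝐱 ^ (d + 1) * ((d : R⟦X⟧) * (1 - 𝐱) + 𝐱)

theorem kernel_sq_mul_derivative_genFun_one (d : ℕ) :
    kernel R d ^ 2 * (𝐱 * d⁄dX R (genFun d d 1)) = 𝐱 * areaNumerator R d := by
  have derivative_kernel :
      d⁄dX R (kernel R d) = -(2 * (1 - 𝐱) + (d + 1 : R⟦X⟧) * 𝐱 ^ d) := by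
    simp only [kernel, map_sub, Derivation.leibniz_pow, Derivation.map_one_eq_zero,
      PowerSeries.derivative_X, smul_eq_mul, nsmul_eq_mul, add_tsub_cancel_right, Nat.cast_add,
      Nat.cast_one, Nat.cast_ofNat, Nat.add_one_sub_one, pow_one]
    ring
  have derivative_eq := congrArg (d⁄dX R) (kernel_mul_genFun_one (R := R) d)
  simp only [Derivation.leibniz, derivative_kernel, map_sub, smul_eq_mul, PowerSeries.derivative_X,
    Derivation.map_one_eq_zero] at derivative_eq
  have hkernel : kernel R d = (1 - 𝐱) ^ 2 - 𝐱 ^ (d + 1) := rfl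
  rw [areaNumerator]
  linear_combination 𝐱 * kernel R d * derivative_eq
    + 𝐱 * (2 * (1 - 𝐱) + (d + 1 : R⟦X⟧) * 𝐱 ^ d) * kernel_mul_genFun_one (R := R) d
    + 𝐱 * (1 - 2 * 𝐱) * hkernel

theorem one_sub_X_pow_mul_genFun_tipl (e d : ℕ) :
    (1 - 𝐱) ^ 4 * genFun e d (fun P => (tipl P : R)) = 𝐱 * (1 - 𝐱) + 𝐱 ^ (e + 1) *
      (heightNumerator R e * genFun d d 1
        + (1 - 𝐱) ^ 2 * genFun d d (fun P => (tipl P : R))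
        + (1 + (e : R⟦X⟧) * (1 - 𝐱)) * (1 - 𝐱) * (𝐱 * d⁄dX R (genFun d d 1))) := by
  rw [genFun_tipl]
  linear_combination 𝐱 * (1 - 𝐱) * mk_choose_two_mul (R := R)
    + genFun d d 1 * mk_sub_mul_choose_two_mul (R := R) e
    + (1 - 𝐱) ^ 2 * genFun d d (fun P => (tipl P : R)) * mk_sub_mul (R := R) e
    + (1 - 𝐱) * (𝐱 * d⁄dX R (genFun d d 1)) * mk_sum_Ico_mul (R := R) e

/-- The numerator of the generating function of the total internal path length on
`steppedDccp d d`; its denominator is `(1 - x) * kernel R d ^ 3`, up to a factor `x`. -/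
noncomputable def pathNumerator (R : Type*) [CommRing R] (d : ℕ) : R⟦X⟧ :=
  kernel R d ^ 2 + 𝐱 ^ (d + 1) *
    (heightNumerator R d * kernel R d + (1 + (d : R⟦X⟧) * (1 - 𝐱)) * areaNumerator R d)

theorem kernel_pow_mul_genFun_tipl_self (d : ℕ) :
    (1 - 𝐱) * kernel R d ^ 3 * genFun d d (fun P => (tipl P : R)) =
      𝐱 * pathNumerator R d := by
  refine (isUnit_one_sub_X R).mul_left_cancel ?_
  have hkernel : kernel R d = (1 - 𝐱) ^ 2 - 𝐱 ^ (d + 1) := rfl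
  rw [pathNumerator]
  linear_combination kernel R d ^ 2 * one_sub_X_pow_mul_genFun_tipl (R := R) d d
    + (1 - 𝐱) ^ 2 * kernel R d ^ 2 * genFun d d (fun P => (tipl P : R)) * hkernel
    + 𝐱 ^ (d + 1) * heightNumerator R d * kernel R d * kernel_mul_genFun_one (R := R) d
    + 𝐱 ^ (d + 1) * (1 + (d : R⟦X⟧) * (1 - 𝐱)) * (1 - 𝐱)
      * kernel_sq_mul_derivative_genFun_one (R := R) d

theorem kernel_pow_mul_genFun_tipl_zero (d : ℕ) :
    (1 - 𝐱) ^ 3 * kernel R d ^ 3 * genFun 0 d (fun P => (tipl P : R)) =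
      𝐱 * kernel R d ^ 3 + 𝐱 ^ 2 * ((1 + 2 * 𝐱) * kernel R d ^ 2 + pathNumerator R d
        + kernel R d * areaNumerator R d) := by
  refine (isUnit_one_sub_X R).mul_left_cancel ?_
  have equation := one_sub_X_pow_mul_genFun_tipl (R := R) 0 d
  simp only [heightNumerator, Nat.cast_zero, Nat.choose_zero_succ, zero_mul, add_zero, zero_add,
    pow_one] at equation
  linear_combination kernel R d ^ 3 * equation
    + 𝐱 * (1 + 2 * 𝐱) * kernel R d ^ 2 * kernel_mul_genFun_one (R := R) d
    + 𝐱 * (1 - 𝐱) * kernel_pow_mul_genFun_tipl_self (R := R) d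
    + 𝐱 * (1 - 𝐱) * kernel R d * kernel_sq_mul_derivative_genFun_one (R := R) d

end FunctionalEquations

section Quotient

theorem coe_ofNat {R : Type*} [CommSemiring R] (n : ℕ) [n.AtLeastTwo] :
    ((ofNat(n) : R[X]) : PowerSeries R) = ofNat(n) :=
  map_ofNat (Polynomial.coeToPowerSeries.ringHom (R := R)) n

theorem coe_g (d : ℕ) : (g d : PowerSeries ℚ) = -2 * (1 - 𝐱) ^ 3 * kernel ℚ d ^ 3 := by
  rw [g, kernel]
  push_cast
  rw [coe_ofNat]
  ring

theorem isUnit_coe_g (d : ℕ) : IsUnit (g d : PowerSeries ℚ) := by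
  rw [PowerSeries.isUnit_iff_constantCoeff, coe_g, kernel, map_mul, map_mul, map_neg, map_ofNat]
  simp

theorem genFun_tipl_mul_coe_g (d : ℕ) :
    genFun 0 d (fun P => (tipl P : ℚ)) * (g d : PowerSeries ℚ) = (f d : PowerSeries ℚ) := by
  have two_mul_choose : 2 * (d.choose 2 : PowerSeries ℚ) = d * (d - 1) := by
    have over_rat : 2 * (d.choose 2 : ℚ) = d * (d - 1) := by
      rw [Nat.cast_choose_two, mul_div_cancel₀ _ two_ne_zero]
    simpa only [map_mul, map_sub, map_natCast, map_ofNat, map_one] using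
      congrArg (PowerSeries.C (R := ℚ)) over_rat
  rw [coe_g, f]
  push_cast
  simp only [coe_ofNat, map_sub, map_add, map_mul, map_pow, map_natCast, map_ofNat, map_one]
  have equation := kernel_pow_mul_genFun_tipl_zero (R := ℚ) d
  simp only [pathNumerator, heightNumerator, areaNumerator] at equation
  rw [kernel] at equation ⊢
  linear_combination -2 * equation - 𝐱 ^ 2 * 𝐱 ^ (d + 1) * (1 - 𝐱) ^ 2
    * ((1 - 𝐱) ^ 2 - 𝐱 ^ (d + 1)) * two_mul_choose

end Quotient

end Dccp

/-- The generating function of `t d` is the rational function `f d / g d`, as an identity of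
formal power series, in which `g d` is invertible. -/
theorem mainTheorem2 (d : ℕ) :
    IsUnit (Dccp.g d : PowerSeries ℚ) ∧
      PowerSeries.mk (fun n : ℕ => (Dccp.t d n : ℚ)) =
        (Dccp.f d : PowerSeries ℚ) * (Dccp.g d : PowerSeries ℚ)⁻¹ := by
  have hg := Dccp.isUnit_coe_g d
  refine ⟨hg, ?_⟩
  rw [PowerSeries.eq_mul_inv_iff_mul_eq (PowerSeries.isUnit_iff_constantCoeff.1 hg).ne_zero,
    ← Dccp.genFun_tipl_mul_coe_g]
  congr 2
  funext n
  rw [Dccp.t_eq_sum_steppedDccp, Nat.cast_sum]
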